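/- For a finite graph $G=(V,E)$, let the VC-dimension of $G$ be the largest $k$ for which there is a $k$-element set $S\subseteq V$ such that every subset $B\subseteq S$ has the form $N(v)\cap S$ for some $v\in V$, where $N(v)$ is the set of vertices adjacent to $v$ (so $v\notin N(v)$). The class of cographs is the smallest class of graphs, closed under isomorphism, that contains the one-vertex graph and contains, with any two graphs, their disjoint union and the graph obtained from their disjoint union by adding all edges between the two. Let $d\ge 1$ be an integer; logarithms are natural. (i) There is a function $\varepsilon=\varepsilon_d:\mathbb{N}\to\mathbb{R}$ with $\varepsilon(n)\to 0$ as $n\to\infty$ such that for every $n\ge 1$, every $n$-vertex graph of VC-dimension at most $d$ contains a clique or an independent set of size at least $e^{(\log n)^{1-\varepsilon(n)}}$. (ii) For every $\delta\in(0,1/2)$ there is a constant $c=c(d,\delta)>0$ such that for every $n\ge 1$, every $n$-vertex graph of VC-dimension at most $d$ has an induced subgraph on at least $e^{c(\log n)^{1-\delta}}$ vertices that is a cograph. -/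

import Mathlib

universe u

open Filter Topology
open scoped SimpleGraph

open Classical in
/-- The VC-dimension of a finite graph: the VC-dimension of the set system formed by the (open)
neighbourhoods of its vertices. -/
noncomputable def graphVCDim {V : Type u} [Fintype V] (G : SimpleGraph V) : ℕ :=
  (Finset.univ.image fun v : V => G.neighborFinset v).vcDim

/-- Cographs (complement reducible graphs): the smallest isomorphism-closed class of graphs that
contains the one-vertex graph and is closed under disjoint union and under the operation of taking
the disjoint union of two graphs and adding all edges between them. -/
inductive IsCograph : {V : Type u} → SimpleGraph V → Prop
  | single {V : Type u} [Unique V] (G : SimpleGraph V) : IsCograph G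
  | disjointUnion {V W : Type u} {G : SimpleGraph V} {H : SimpleGraph W} :
      IsCograph G → IsCograph H → IsCograph (G ⊕g H)
  | join {V W : Type u} {G : SimpleGraph V} {H : SimpleGraph W} :
      IsCograph G → IsCograph H → IsCograph ((G ⊕g H) ⊔ completeBipartiteGraph V W)
  | iso {V W : Type u} {G : SimpleGraph V} {H : SimpleGraph W} :
      Nonempty (G ≃g H) → IsCograph G → IsCograph H

/-!
The proof is a recursion for the largest size `f(n)` of an induced cograph in an `n`-vertex graph of
VC-dimension at most `d`. Fix a small `η`. By sampling and the Sauer–Shelah lemma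
(`card_le_of_distinct_traces`), there are only polynomially many in `1 / η` neighbourhoods which
differ pairwise in a proportion `η` of the vertices (`exists_packing_bound`). So the vertices split
into `K ≤ η ^ (-C)` classes within which all neighbourhoods are `2 η`-close, and as long as half of
the vertices are left, some class still has `n / (2 K)` of them. Hence half of the vertices can be
covered by disjoint cographs ("cells") of equal size `m ≤ f(n / (2 K))`, each inside one class
(`exists_cells`).

Two cells are completely joined or completely non-adjacent unless one of them meets the difference of
the neighbourhoods of two vertices of the other. Each cell has differences covering at most
`2 η n m ^ 2` vertices, so this relation between cells has small out-degrees, and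
`exists_pairwise_unrelated` selects `t` cells, any two of which are homogeneous to each other, where
`t` is a small power of `1 / η`. One vertex from each selected cell gives a `t`-vertex graph, which
contains a cograph on `f(t)` vertices; substituting the cells for its vertices gives a cograph
(`IsCographOn.biUnion`) and `f(n) ≥ f(n / (2 K)) f(t)` (`exists_isCographOn_mul`).

In logarithmic terms, with `x = log n`, `g(x) = log f(n)` and `log (1 / η) = 5 xᵖ`, this reads
`g(x) ≥ g(x - A xᵖ) + g(xᵖ)`, valid for `g(x) ≤ xᵖ`. It preserves the lower bound `c xᵖ` for every
`p < 1` and every large `x`, because the loss is of order `x ^ (2 p - 1)` and the gain is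
`x ^ (p ^ 2)` (`rpow_le_sub_rpow_add_rpow`). This is the bound on cographs
(`exists_isCographOn_exp_le`).

A cograph on `s` vertices has a clique or an independent set of size at least `√s`, so the
exponent `1 - ε` for homogeneous sets can be taken above every `1 - δ` for large `n`. The function `ε`
is read off from the exact extremal number `homogeneousNumber`.
-/

/-! ### Induced cographs inside a fixed graph -/

open Classical in
/-- `IsCographOn G S`: the finite vertex set `S` induces a cograph in `G`. The recursive definition
of cographs is carried out inside the fixed ambient graph `G`, so that no isomorphisms are
needed. In particular `S` is nonempty. -/
inductive IsCographOn {V : Type u} (G : SimpleGraph V) : Finset V → Prop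
  | singleton (v : V) : IsCographOn G {v}
  | union {A B : Finset V} : IsCographOn G A → IsCographOn G B → Disjoint A B →
      (∀ a ∈ A, ∀ b ∈ B, ¬ G.Adj a b) → IsCographOn G (A ∪ B)
  | join {A B : Finset V} : IsCographOn G A → IsCographOn G B → Disjoint A B →
      (∀ a ∈ A, ∀ b ∈ B, G.Adj a b) → IsCographOn G (A ∪ B)

namespace IsCographOn

open Classical

variable {V : Type u} {G : SimpleGraph V} {S : Finset V}

theorem nonempty (h : IsCographOn G S) : S.Nonempty := by
  induction h with
  | singleton v => exact Finset.singleton_nonempty v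
  | union _ _ _ _ ihA _ => exact ihA.mono Finset.subset_union_left
  | join _ _ _ _ ihA _ => exact ihA.mono Finset.subset_union_left

theorem mono (h : IsCographOn G S) : ∀ T ⊆ S, T.Nonempty → IsCographOn G T := by
  induction h with
  | singleton v =>
    intro T hT hne
    rw [(Finset.Nonempty.subset_singleton_iff hne).1 hT]
    exact .singleton v
  | @union A B _ _ hAB hadj ihA ihB =>
    intro T hT hne
    have hTu : T = (T ∩ A) ∪ (T ∩ B) := by
      rw [← Finset.inter_union_distrib_left]; exact (Finset.inter_eq_left.2 hT).symm
    rcases (T ∩ A).eq_empty_or_nonempty with h1 | h1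
    · rw [h1, Finset.empty_union] at hTu
      exact ihB T (hTu ▸ Finset.inter_subset_right) hne
    rcases (T ∩ B).eq_empty_or_nonempty with h2 | h2
    · rw [h2, Finset.union_empty] at hTu
      exact ihA T (hTu ▸ Finset.inter_subset_right) hne
    rw [hTu]
    exact .union (ihA _ Finset.inter_subset_right h1) (ihB _ Finset.inter_subset_right h2)
      (hAB.mono Finset.inter_subset_right Finset.inter_subset_right)
      fun a ha b hb ↦ hadj a (Finset.mem_inter.1 ha).2 b (Finset.mem_inter.1 hb).2
  | @join A B _ _ hAB hadj ihA ihB =>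
    intro T hT hne
    have hTu : T = (T ∩ A) ∪ (T ∩ B) := by
      rw [← Finset.inter_union_distrib_left]; exact (Finset.inter_eq_left.2 hT).symm
    rcases (T ∩ A).eq_empty_or_nonempty with h1 | h1
    · rw [h1, Finset.empty_union] at hTu
      exact ihB T (hTu ▸ Finset.inter_subset_right) hne
    rcases (T ∩ B).eq_empty_or_nonempty with h2 | h2
    · rw [h2, Finset.union_empty] at hTu
      exact ihA T (hTu ▸ Finset.inter_subset_right) hne
    rw [hTu]
    exact .join (ihA _ Finset.inter_subset_right h1) (ihB _ Finset.inter_subset_right h2)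
      (hAB.mono Finset.inter_subset_right Finset.inter_subset_right)
      fun a ha b hb ↦ hadj a (Finset.mem_inter.1 ha).2 b (Finset.mem_inter.1 hb).2

/-- Any two distinct vertices induce a cograph. -/
theorem pair {u v : V} (h : u ≠ v) : IsCographOn G {u, v} := by
  rw [Finset.insert_eq]
  by_cases hadj : G.Adj u v
  · exact .join (.singleton u) (.singleton v) (by simpa using h) (by simpa using hadj)
  · exact .union (.singleton u) (.singleton v) (by simpa using h) (by simpa using hadj)

/-- Substituting cographs for the vertices of a cograph gives a cograph. -/
theorem biUnion (h : IsCographOn G S) (C : V → Finset V)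
    (hC : ∀ s ∈ S, IsCographOn G (C s))
    (hdisj : ∀ s ∈ S, ∀ s' ∈ S, s ≠ s' → Disjoint (C s) (C s'))
    (hadj : ∀ s ∈ S, ∀ s' ∈ S, s ≠ s' → ∀ a ∈ C s, ∀ b ∈ C s', (G.Adj a b ↔ G.Adj s s')) :
    IsCographOn G (S.biUnion C) := by
  induction h with
  | singleton v => simpa using hC v (by simp)
  | @union A B _ _ hAB hG ihA ihB =>
    rw [Finset.union_biUnion]
    have hA : A ⊆ A ∪ B := Finset.subset_union_left
    have hB : B ⊆ A ∪ B := Finset.subset_union_right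
    refine .union
      (ihA (fun s hs ↦ hC s (hA hs)) (fun s hs t ht ↦ hdisj s (hA hs) t (hA ht))
        (fun s hs t ht ↦ hadj s (hA hs) t (hA ht)))
      (ihB (fun s hs ↦ hC s (hB hs)) (fun s hs t ht ↦ hdisj s (hB hs) t (hB ht))
        (fun s hs t ht ↦ hadj s (hB hs) t (hB ht))) ?_ ?_
    · simp only [Finset.disjoint_biUnion_left, Finset.disjoint_biUnion_right]
      exact fun s hs t ht ↦ hdisj _ (hA ‹_›) _ (hB ‹_›) (by
        rintro rfl; exact Finset.disjoint_left.1 hAB ‹_› ‹_›)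
    · intro a ha b hb
      obtain ⟨s, hs, has⟩ := Finset.mem_biUnion.1 ha
      obtain ⟨t, ht, hbt⟩ := Finset.mem_biUnion.1 hb
      have hst : s ≠ t := by rintro rfl; exact Finset.disjoint_left.1 hAB hs ht
      rw [hadj s (hA hs) t (hB ht) hst a has b hbt]
      exact hG s hs t ht
  | @join A B _ _ hAB hG ihA ihB =>
    rw [Finset.union_biUnion]
    have hA : A ⊆ A ∪ B := Finset.subset_union_left
    have hB : B ⊆ A ∪ B := Finset.subset_union_right
    refine .join
      (ihA (fun s hs ↦ hC s (hA hs)) (fun s hs t ht ↦ hdisj s (hA hs) t (hA ht))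
        (fun s hs t ht ↦ hadj s (hA hs) t (hA ht)))
      (ihB (fun s hs ↦ hC s (hB hs)) (fun s hs t ht ↦ hdisj s (hB hs) t (hB ht))
        (fun s hs t ht ↦ hadj s (hB hs) t (hB ht))) ?_ ?_
    · simp only [Finset.disjoint_biUnion_left, Finset.disjoint_biUnion_right]
      exact fun s hs t ht ↦ hdisj _ (hA ‹_›) _ (hB ‹_›) (by
        rintro rfl; exact Finset.disjoint_left.1 hAB ‹_› ‹_›)
    · intro a ha b hb
      obtain ⟨s, hs, has⟩ := Finset.mem_biUnion.1 ha
      obtain ⟨t, ht, hbt⟩ := Finset.mem_biUnion.1 hb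
      have hst : s ≠ t := by rintro rfl; exact Finset.disjoint_left.1 hAB hs ht
      rw [hadj s (hA hs) t (hB ht) hst a has b hbt]
      exact hG s hs t ht

/-- Cographs are perfect; the consequence recorded here is `|S| ≤ ω(S) α(S)`. -/
theorem exists_isClique_isIndepSet (h : IsCographOn G S) :
    ∃ Q ⊆ S, ∃ I ⊆ S, G.IsClique (Q : Set V) ∧ G.IsIndepSet (I : Set V) ∧
      S.card ≤ Q.card * I.card := by
  induction h with
  | singleton v =>
    exact ⟨{v}, subset_rfl, {v}, subset_rfl, by simp, by simp [SimpleGraph.IsIndepSet], by simp⟩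
  | @union A B _ _ hAB hG ihA ihB =>
    obtain ⟨Q₁, hQ₁, I₁, hI₁, hc₁, hi₁, h₁⟩ := ihA
    obtain ⟨Q₂, hQ₂, I₂, hI₂, hc₂, hi₂, h₂⟩ := ihB
    have hI : G.IsIndepSet ((I₁ ∪ I₂ : Finset V) : Set V) := by
      intro a ha b hb hab
      rw [Finset.mem_coe, Finset.mem_union] at ha hb
      rcases ha with ha | ha <;> rcases hb with hb | hb
      · exact hi₁ ha hb hab
      · exact hG a (hI₁ ha) b (hI₂ hb)
      · exact fun h ↦ hG b (hI₁ hb) a (hI₂ ha) h.symm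
      · exact hi₂ ha hb hab
    have hIs : I₁ ∪ I₂ ⊆ A ∪ B := Finset.union_subset_union hI₁ hI₂
    have hIc : (I₁ ∪ I₂).card = I₁.card + I₂.card :=
      Finset.card_union_of_disjoint (hAB.mono hI₁ hI₂)
    have hS : (A ∪ B).card = A.card + B.card := Finset.card_union_of_disjoint hAB
    rcases le_total Q₁.card Q₂.card with hle | hle
    · refine ⟨Q₂, hQ₂.trans Finset.subset_union_right, _, hIs, hc₂, hI, ?_⟩
      rw [hIc, hS]; nlinarith [Nat.mul_le_mul_right I₁.card hle]
    · refine ⟨Q₁, hQ₁.trans Finset.subset_union_left, _, hIs, hc₁, hI, ?_⟩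
      rw [hIc, hS]; nlinarith [Nat.mul_le_mul_right I₂.card hle]
  | @join A B _ _ hAB hG ihA ihB =>
    obtain ⟨Q₁, hQ₁, I₁, hI₁, hc₁, hi₁, h₁⟩ := ihA
    obtain ⟨Q₂, hQ₂, I₂, hI₂, hc₂, hi₂, h₂⟩ := ihB
    have hQ : G.IsClique ((Q₁ ∪ Q₂ : Finset V) : Set V) := by
      intro a ha b hb hab
      rw [Finset.mem_coe, Finset.mem_union] at ha hb
      rcases ha with ha | ha <;> rcases hb with hb | hb
      · exact hc₁ ha hb hab
      · exact hG a (hQ₁ ha) b (hQ₂ hb)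
      · exact (hG b (hQ₁ hb) a (hQ₂ ha)).symm
      · exact hc₂ ha hb hab
    have hQs : Q₁ ∪ Q₂ ⊆ A ∪ B := Finset.union_subset_union hQ₁ hQ₂
    have hQc : (Q₁ ∪ Q₂).card = Q₁.card + Q₂.card :=
      Finset.card_union_of_disjoint (hAB.mono hQ₁ hQ₂)
    have hS : (A ∪ B).card = A.card + B.card := Finset.card_union_of_disjoint hAB
    rcases le_total I₁.card I₂.card with hle | hle
    · refine ⟨_, hQs, I₂, hI₂.trans Finset.subset_union_right, hQ, hi₂, ?_⟩
      rw [hQc, hS]; nlinarith [Nat.mul_le_mul_left Q₁.card hle]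
    · refine ⟨_, hQs, I₁, hI₁.trans Finset.subset_union_left, hQ, hi₁, ?_⟩
      rw [hQc, hS]; nlinarith [Nat.mul_le_mul_left Q₂.card hle]

/-- The recursion inside `G` agrees with the abstract class of cographs. -/
theorem isCograph (h : IsCographOn G S) : IsCograph (G.induce (S : Set V)) := by
  induction h with
  | singleton v =>
    have : Unique (({v} : Finset V) : Set V) := by rw [Finset.coe_singleton]; infer_instance
    exact .single _
  | @union A B _ _ hAB hG ihA ihB =>
    let e : (((A ∪ B : Finset V) : Set V)) ≃ (A : Set V) ⊕ (B : Set V) :=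
      (Equiv.setCongr (Finset.coe_union A B)).trans
        (Equiv.Set.union (Finset.disjoint_coe.2 hAB))
    have hl : ∀ x : (A : Set V), ((e.symm (Sum.inl x) : _) : V) = x := fun x ↦ rfl
    have hr : ∀ x : (B : Set V), ((e.symm (Sum.inr x) : _) : V) = x := fun x ↦ rfl
    refine .iso ⟨⟨e.symm, ?_⟩⟩ (.disjointUnion ihA ihB)
    rintro (⟨a, ha⟩ | ⟨a, ha⟩) (⟨b, hb⟩ | ⟨b, hb⟩) <;>
      simp only [SimpleGraph.comap_adj, Function.Embedding.subtype_apply, hl, hr,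
        SimpleGraph.sum_adj]
    · simpa using hG a ha b hb
    · simpa using fun h ↦ hG b hb a ha h.symm
  | @join A B _ _ hAB hG ihA ihB =>
    let e : (((A ∪ B : Finset V) : Set V)) ≃ (A : Set V) ⊕ (B : Set V) :=
      (Equiv.setCongr (Finset.coe_union A B)).trans
        (Equiv.Set.union (Finset.disjoint_coe.2 hAB))
    have hl : ∀ x : (A : Set V), ((e.symm (Sum.inl x) : _) : V) = x := fun x ↦ rfl
    have hr : ∀ x : (B : Set V), ((e.symm (Sum.inr x) : _) : V) = x := fun x ↦ rfl
    refine .iso ⟨⟨e.symm, ?_⟩⟩ (.join ihA ihB)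
    rintro (⟨a, ha⟩ | ⟨a, ha⟩) (⟨b, hb⟩ | ⟨b, hb⟩) <;>
      simp only [SimpleGraph.comap_adj, Function.Embedding.subtype_apply, hl, hr,
        SimpleGraph.sum_adj, SimpleGraph.sup_adj, completeBipartiteGraph_adj]
    · simp
    · simpa using hG a ha b hb
    · simpa using (hG b hb a ha).symm
    · simp

end IsCographOn

/-! ### Packing of neighbourhoods -/

/-- The neighbourhoods of `G` shatter no set of more than `d` vertices. -/
def ShattersAtMost {V : Type u} (G : SimpleGraph V) (d : ℕ) : Prop :=
  ∀ T : Finset V, (∀ B ⊆ T, ∃ v, ∀ w ∈ T, G.Adj v w ↔ w ∈ B) → T.card ≤ d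

theorem shattersAtMost_of_graphVCDim_le {V : Type u} [Fintype V] {G : SimpleGraph V} {d : ℕ}
    (h : graphVCDim G ≤ d) : ShattersAtMost G d := by
  classical
  intro T hT
  refine le_trans (Finset.Shatters.card_le_vcDim ?_) h
  intro B hB
  obtain ⟨v, hv⟩ := hT B hB
  refine ⟨_, Finset.mem_image_of_mem _ (Finset.mem_univ v), ?_⟩
  ext w
  simp only [Finset.mem_inter, SimpleGraph.mem_neighborFinset]
  exact ⟨fun ⟨h1, h2⟩ ↦ (hv w h1).1 h2, fun h1 ↦ ⟨hB h1, (hv w (hB h1)).2 h1⟩⟩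

theorem sum_range_choose_le_pow (s d : ℕ) :
    ∑ k ∈ Finset.range (d + 1), s.choose k ≤ (s + 1) ^ d := by
  induction d with
  | zero => simp
  | succ d ih =>
    rw [Finset.sum_range_succ]
    have h1 : s.choose (d + 1) ≤ s ^ (d + 1) := Nat.choose_le_pow s (d + 1)
    have h2 : s ^ d ≤ (s + 1) ^ d := Nat.pow_le_pow_left (Nat.le_succ s) d
    calc _ ≤ (s + 1) ^ d + s ^ (d + 1) := add_le_add ih h1
      _ ≤ (s + 1) ^ d + (s + 1) ^ d * s := by rw [pow_succ s]; gcongr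
      _ = (s + 1) ^ (d + 1) := by ring

section Packing

open Classical

variable {V : Type u} (G : SimpleGraph V)

/-- The vertices of `X` adjacent to exactly one of `u` and `v`. -/
noncomputable def nbrDiff (X : Finset V) (u v : V) : Finset V :=
  X.filter fun w ↦ ¬ (G.Adj u w ↔ G.Adj v w)

variable {G}

theorem mem_nbrDiff {X : Finset V} {u v w : V} :
    w ∈ nbrDiff G X u v ↔ w ∈ X ∧ ¬ (G.Adj u w ↔ G.Adj v w) := Finset.mem_filter

theorem card_nbrDiff_le (X : Finset V) (u v p : V) :
    (nbrDiff G X u v).card ≤ (nbrDiff G X u p).card + (nbrDiff G X v p).card := by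
  refine (Finset.card_le_card ?_).trans (Finset.card_union_le _ _)
  intro w
  simp only [Finset.mem_union, mem_nbrDiff]
  tauto

/-- The Sauer–Shelah lemma: vertices with distinct traces on `W` number at most
`(|W| + 1) ^ d`. -/
theorem card_le_of_distinct_traces {d : ℕ} (hG : ShattersAtMost G d) (P W : Finset V)
    (hP : ∀ x ∈ P, ∀ y ∈ P, x ≠ y → (nbrDiff G W x y).Nonempty) :
    P.card ≤ (W.card + 1) ^ d := by
  set 𝒜 : Finset (Finset V) := P.image fun x ↦ W.filter (G.Adj x) with h𝒜
  have hcard : 𝒜.card = P.card := by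
    refine Finset.card_image_of_injOn fun x hx y hy hxy ↦ ?_
    by_contra hne
    obtain ⟨w, hw⟩ := hP x hx y hy hne
    rw [mem_nbrDiff] at hw
    have := congrArg (fun s ↦ w ∈ s) hxy
    simp only [Finset.mem_filter, hw.1, true_and, eq_iff_iff] at this
    exact hw.2 this
  have hsub : 𝒜.shatterer ⊆ (Finset.range (d + 1)).biUnion fun k ↦ W.powersetCard k := by
    intro T hT
    rw [Finset.mem_shatterer] at hT
    have hTW : T ⊆ W := by
      obtain ⟨u, hu, hTu⟩ := hT.exists_superset
      obtain ⟨x, -, rfl⟩ := Finset.mem_image.1 hu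
      exact hTu.trans (Finset.filter_subset _ _)
    have hTd : T.card ≤ d := by
      refine hG T fun B hB ↦ ?_
      obtain ⟨u, hu, huB⟩ := hT hB
      obtain ⟨x, -, rfl⟩ := Finset.mem_image.1 hu
      refine ⟨x, fun w hw ↦ ?_⟩
      rw [← huB]
      simp [hw, hTW hw]
    simp only [Finset.mem_biUnion, Finset.mem_range, Finset.mem_powersetCard]
    exact ⟨T.card, by omega, hTW, rfl⟩
  calc P.card = 𝒜.card := hcard.symm
    _ ≤ 𝒜.shatterer.card := Finset.card_le_card_shatterer 𝒜
    _ ≤ _ := Finset.card_le_card hsub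
    _ ≤ ∑ k ∈ Finset.range (d + 1), (W.powersetCard k).card := Finset.card_biUnion_le
    _ = ∑ k ∈ Finset.range (d + 1), W.card.choose k := by simp [Finset.card_powersetCard]
    _ ≤ _ := sum_range_choose_le_pow _ _

/-- If the neighbourhoods of the vertices of `P` differ pairwise in a proportion `η` of `X`, then a
random sequence of `s` elements of `X` separates them all, provided `|P|² (1 - η)ˢ < 1`. -/
theorem exists_separating {P X : Finset V} {η : ℝ} (hX : X.Nonempty) {s : ℕ} (hη1 : η ≤ 1)
    (hP : ∀ x ∈ P, ∀ y ∈ P, x ≠ y → η * X.card ≤ (nbrDiff G X x y).card)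
    (hs : (P.card : ℝ) ^ 2 * (1 - η) ^ s < 1) :
    ∃ W : Finset V, W.card ≤ s ∧ ∀ x ∈ P, ∀ y ∈ P, x ≠ y → (nbrDiff G W x y).Nonempty := by
  set Bad : Finset (Fin s → V) := P.offDiag.biUnion fun q ↦
    Fintype.piFinset fun _ : Fin s ↦ X \ nbrDiff G X q.1 q.2 with hBad
  have hn : (0 : ℝ) < X.card := by exact_mod_cast hX.card_pos
  have hterm : ∀ q ∈ P.offDiag,
      (((Fintype.piFinset fun _ : Fin s ↦ X \ nbrDiff G X q.1 q.2).card : ℕ) : ℝ) ≤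
        ((1 - η) * X.card) ^ s := by
    intro q hq
    obtain ⟨h1, h2, h3⟩ := Finset.mem_offDiag.1 hq
    have hsub : nbrDiff G X q.1 q.2 ⊆ X := Finset.filter_subset _ _
    rw [Fintype.card_piFinset, Finset.prod_const, Finset.card_univ, Fintype.card_fin,
      Finset.card_sdiff_of_subset hsub, Nat.cast_pow, Nat.cast_sub (Finset.card_le_card hsub)]
    have h4 := hP _ h1 _ h2 h3
    have h5 : ((nbrDiff G X q.1 q.2).card : ℝ) ≤ X.card := by
      exact_mod_cast Finset.card_le_card hsub
    refine pow_le_pow_left₀ (by linarith) ?_ s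
    linarith
  have hcard : (Bad.card : ℝ) < (Fintype.piFinset fun _ : Fin s ↦ X).card := by
    have h1 : (Bad.card : ℝ) ≤ ∑ q ∈ P.offDiag, ((1 - η) * X.card : ℝ) ^ s := by
      refine le_trans ?_ (Finset.sum_le_sum hterm)
      exact_mod_cast Finset.card_biUnion_le
    rw [Finset.sum_const, nsmul_eq_mul] at h1
    have h2 : ((P.offDiag.card : ℕ) : ℝ) ≤ (P.card : ℝ) ^ 2 := by
      rw [Finset.offDiag_card, sq]; exact_mod_cast Nat.sub_le _ _
    rw [Fintype.card_piFinset, Finset.prod_const, Finset.card_univ, Fintype.card_fin, Nat.cast_pow]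
    have h3 : (0 : ℝ) ≤ (1 - η) ^ s := pow_nonneg (by linarith) s
    have h4 : (0 : ℝ) < (X.card : ℝ) ^ s := pow_pos hn s
    rw [mul_pow] at h1
    calc (Bad.card : ℝ) ≤ _ := h1
      _ ≤ (P.card : ℝ) ^ 2 * ((1 - η) ^ s * (X.card : ℝ) ^ s) := by gcongr
      _ = ((P.card : ℝ) ^ 2 * (1 - η) ^ s) * (X.card : ℝ) ^ s := by ring
      _ < 1 * (X.card : ℝ) ^ s := by gcongr
      _ = _ := one_mul _
  obtain ⟨f, hf, hfB⟩ := Finset.exists_mem_notMem_of_card_lt_card (by exact_mod_cast hcard)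
  refine ⟨Finset.univ.image f, Finset.card_image_le.trans (by simp), fun x hx y hy hxy ↦ ?_⟩
  rw [hBad, Finset.mem_biUnion] at hfB
  push Not at hfB
  have h1 := hfB (x, y) (Finset.mem_offDiag.2 ⟨hx, hy, hxy⟩)
  rw [Fintype.mem_piFinset] at h1 hf
  push Not at h1
  obtain ⟨i, hi⟩ := h1
  simp only [Finset.mem_sdiff, hf i, true_and, not_not, mem_nbrDiff] at hi
  exact ⟨f i, mem_nbrDiff.2 ⟨Finset.mem_image_of_mem f (Finset.mem_univ i), hi⟩⟩

end Packing

/-- A polynomial form of Haussler's packing lemma: neighbourhoods that differ pairwise in a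
proportion `η` of `X` number at most polynomially many in `1 / η`. -/
theorem exists_packing_bound (d : ℕ) : ∃ B : ℝ, 1 ≤ B ∧
    ∀ {V : Type u} (G : SimpleGraph V), ShattersAtMost G d →
    ∀ (X P : Finset V) (η : ℝ), X.Nonempty → 0 < η → η ≤ 1 →
    (∀ x ∈ P, ∀ y ∈ P, x ≠ y → η * X.card ≤ (nbrDiff G X x y).card) →
    (P.card : ℝ) ≤ (B / η ^ 2) ^ d := by
  have hlim : Tendsto (fun z : ℝ ↦ 4 * 3 ^ (2 * d) * (z ^ (4 * d) * Real.exp (-z))) atTop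
      (𝓝 (4 * 3 ^ (2 * d) * 0)) :=
    (Real.tendsto_pow_mul_exp_neg_atTop_nhds_zero (4 * d)).const_mul _
  rw [mul_zero] at hlim
  obtain ⟨A, hA⟩ := Filter.eventually_atTop.1
    ((hlim.eventually (gt_mem_nhds one_pos)).and (eventually_ge_atTop (1 : ℝ)))
  have hA1 : 1 ≤ A := (hA A le_rfl).2
  refine ⟨3 * A, by linarith, fun {V} G hG X P η hX hη0 hη1 hP ↦ ?_⟩
  -- the sample size: `η * s` is at least `A / η`, while `s + 1` is at most `3 (η * s) ^ 2`
  set s : ℕ := ⌈A / η ^ 2⌉₊ with hs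
  have hη2 : η ^ 2 ≤ 1 := pow_le_one₀ hη0.le hη1
  have hq : 1 ≤ A / η ^ 2 := by rw [le_div_iff₀ (by positivity)]; linarith
  have hs1 : A / η ^ 2 ≤ s := Nat.le_ceil _
  have hs2 : (s : ℝ) + 1 ≤ 3 * A / η ^ 2 := by
    have : (s : ℝ) < A / η ^ 2 + 1 := Nat.ceil_lt_add_one (by linarith)
    rw [mul_div_assoc]; linarith
  have hzA : A / η ≤ η * s := by
    calc A / η = η * (A / η ^ 2) := by field_simp
      _ ≤ η * s := by gcongr
  have hz : A ≤ η * s := by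
    refine le_trans ?_ hzA
    rw [le_div_iff₀ hη0]; nlinarith
  have hs3 : (s : ℝ) + 1 ≤ 3 * (η * s) ^ 2 := by
    refine hs2.trans ?_
    have h1 : (A / η) ^ 2 ≤ (η * s) ^ 2 := pow_le_pow_left₀ (by positivity) hzA 2
    rw [div_pow] at h1
    have h2 : A / η ^ 2 ≤ A ^ 2 / η ^ 2 := by gcongr; nlinarith
    rw [mul_div_assoc]; linarith
  suffices h : P.card ≤ (s + 1) ^ d by
    calc (P.card : ℝ) ≤ ((s : ℝ) + 1) ^ d := by exact_mod_cast h
      _ ≤ _ := pow_le_pow_left₀ (by positivity) hs2 d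
  by_contra! hlt
  obtain ⟨P', hP', hP'c⟩ := Finset.exists_subset_card_eq (Nat.succ_le_of_lt hlt)
  obtain ⟨W, hW, hsep⟩ := exists_separating (G := G) (P := P') (s := s) hX hη1
    (fun x hx y hy ↦ hP x (hP' hx) y (hP' hy)) (by
      have h1 : (1 - η) ^ s ≤ Real.exp (-(η * s)) := by
        have : 1 - η ≤ Real.exp (-η) := by linarith [Real.add_one_le_exp (-η)]
        calc (1 - η) ^ s ≤ Real.exp (-η) ^ s := pow_le_pow_left₀ (by linarith) this s
          _ = _ := by rw [← Real.exp_nat_mul]; ring_nf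
      have h2 : (P'.card : ℝ) ≤ 2 * (3 * (η * s) ^ 2) ^ d := by
        rw [hP'c]; push_cast
        have : (1 : ℝ) ≤ ((s : ℝ) + 1) ^ d := one_le_pow₀ (by linarith [Nat.cast_nonneg (α := ℝ) s])
        have := pow_le_pow_left₀ (by positivity) hs3 d
        linarith
      calc (P'.card : ℝ) ^ 2 * (1 - η) ^ s
          ≤ (2 * (3 * (η * s) ^ 2) ^ d) ^ 2 * Real.exp (-(η * s)) := by
            gcongr
        _ = 4 * 3 ^ (2 * d) * ((η * s) ^ (4 * d) * Real.exp (-(η * s))) := by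
            rw [mul_pow 3, mul_pow, mul_pow, ← pow_mul, ← pow_mul, ← pow_mul]
            ring_nf
        _ < 1 := (hA _ hz).1)
  have := card_le_of_distinct_traces hG P' W hsep
  have h3 : (W.card + 1) ^ d ≤ (s + 1) ^ d := by gcongr
  omega

/-! ### Cells and the recursive construction -/

section Cells

open Classical

/-- A relation with out-degrees at most `D` on a set of at least `t (2 D + 1)` elements admits `t`
pairwise unrelated elements: some element also has in-degree at most `D`, so choosing it excludes at
most `2 D + 1` elements, itself included. -/
theorem exists_pairwise_unrelated {α : Type*} (R : α → α → Prop) (D : ℕ) (t : ℕ) :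
    ∀ C : Finset α, (∀ a ∈ C, (C.filter fun b ↦ R a b).card ≤ D) → t * (2 * D + 1) ≤ C.card →
      ∃ I ⊆ C, I.card = t ∧ ∀ a ∈ I, ∀ b ∈ I, a ≠ b → ¬ R a b := by
  induction t with
  | zero => exact fun C _ _ ↦ ⟨∅, by simp, by simp, by simp⟩
  | succ t ih =>
    intro C hC hcard
    have hne : C.Nonempty := Finset.card_pos.1 (lt_of_lt_of_le (by positivity) hcard)
    obtain ⟨a, ha, hin⟩ : ∃ a ∈ C, (C.filter fun b ↦ R b a).card ≤ D := by
      have hsum : ∑ a ∈ C, (C.filter fun b ↦ R b a).card ≤ ∑ a ∈ C, D := by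
        have := Finset.sum_card_bipartiteAbove_eq_sum_card_bipartiteBelow (s := C) (t := C) R
        simp only [Finset.bipartiteAbove, Finset.bipartiteBelow] at this
        rw [← this]
        exact Finset.sum_le_sum hC
      exact Finset.exists_le_of_sum_le hne hsum
    set E : Finset α := insert a ((C.filter fun b ↦ R a b) ∪ C.filter fun b ↦ R b a) with hE
    have hEc : E.card ≤ 2 * D + 1 := by
      have h1 := Finset.card_insert_le a ((C.filter fun b ↦ R a b) ∪ C.filter fun b ↦ R b a)
      have h2 := Finset.card_union_le (C.filter fun b ↦ R a b) (C.filter fun b ↦ R b a)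
      have h3 := hC a ha
      rw [← hE] at h1
      omega
    obtain ⟨I, hI, hIc, hIR⟩ := ih (C \ E)
      (fun b hb ↦ (Finset.card_le_card (Finset.filter_subset_filter _ Finset.sdiff_subset)).trans
        (hC b (Finset.mem_sdiff.1 hb).1)) (by
        have h1 := Finset.le_card_sdiff E C
        have h2 : (t + 1) * (2 * D + 1) = t * (2 * D + 1) + (2 * D + 1) := by ring
        omega)
    have hIE : ∀ b ∈ I, b ∈ C ∧ b ∉ E := fun b hb ↦ Finset.mem_sdiff.1 (hI hb)
    have haI : a ∉ I := fun h ↦ (hIE a h).2 (Finset.mem_insert_self _ _)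
    refine ⟨insert a I, Finset.insert_subset ha fun b hb ↦ (hIE b hb).1,
      by rw [Finset.card_insert_of_notMem haI, hIc], ?_⟩
    intro b hb c hc hbc
    rw [Finset.mem_insert] at hb hc
    rcases hb with rfl | hb <;> rcases hc with rfl | hc
    · exact absurd rfl hbc
    · intro h
      have := hIE c hc
      simp only [hE, Finset.mem_insert, Finset.mem_union, Finset.mem_filter] at this
      tauto
    · intro h
      have := hIE b hb
      simp only [hE, Finset.mem_insert, Finset.mem_union, Finset.mem_filter] at this
      tauto
    · exact hIR b hb c hc hbc

variable {V : Type u} {G : SimpleGraph V}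

/-- Greedy extraction of `j` disjoint cographs on `m` vertices from `X`, each inside one class of
vertices whose neighbourhoods are close to that of a common centre. While half of `X` is left, one of
the at most `K` classes still has `|X| / (2 K)` elements. -/
theorem exists_cells {X P : Finset V} {K m r : ℕ} (hPK : P.card ≤ K)
    (hcov : ∀ x ∈ X, ∃ p ∈ P, 2 * (nbrDiff G X x p).card ≤ r)
    (hm : ∀ Z ⊆ X, Z.Nonempty → X.card ≤ 2 * K * Z.card → ∃ A ⊆ Z, A.card = m ∧ IsCographOn G A)
    (j : ℕ) (hj : 2 * m * j ≤ X.card) (hX : X.Nonempty) :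
    ∃ 𝒞 : Finset (Finset V), 𝒞.card = j ∧
      (∀ A ∈ 𝒞, A ⊆ X ∧ A.card = m ∧ IsCographOn G A ∧
        ∀ u ∈ A, ∀ v ∈ A, (nbrDiff G X u v).card ≤ r) ∧
      ∀ A ∈ 𝒞, ∀ B ∈ 𝒞, A ≠ B → Disjoint A B := by
  induction j with
  | zero => exact ⟨∅, by simp, by simp, by simp⟩
  | succ j ih =>
    have hj' : 2 * m * j + 2 * m ≤ X.card := by rw [Nat.mul_succ] at hj; exact hj
    obtain ⟨𝒞, h𝒞j, h𝒞, hdisj⟩ := ih (by omega)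
    set Y : Finset V := X \ 𝒞.biUnion id with hY
    have hUc : (𝒞.biUnion id).card ≤ j * m := by
      rw [← h𝒞j]
      exact Finset.card_biUnion_le_card_mul _ _ _ fun A hA ↦ (h𝒞 A hA).2.1.le
    have hYc : X.card ≤ 2 * Y.card := by
      have h1 := Finset.le_card_sdiff (𝒞.biUnion id) X
      have h2 : 2 * m * j = 2 * (j * m) := by ring
      rw [← hY] at h1
      omega
    have hYne : Y.Nonempty := by
      rw [← Finset.card_pos]; have := hX.card_pos; omega
    obtain ⟨p, hp, hpY⟩ : ∃ p ∈ P,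
        Y.card ≤ P.card * (Y.filter fun x ↦ 2 * (nbrDiff G X x p).card ≤ r).card := by
      have hYs : Y ⊆ P.biUnion fun p ↦ Y.filter fun x ↦ 2 * (nbrDiff G X x p).card ≤ r := by
        intro x hx
        obtain ⟨p, hp, hxp⟩ := hcov x (Finset.mem_sdiff.1 hx).1
        exact Finset.mem_biUnion.2 ⟨p, hp, Finset.mem_filter.2 ⟨hx, hxp⟩⟩
      have hPne : P.Nonempty := by
        obtain ⟨x, hx⟩ := hX
        obtain ⟨p, hp, -⟩ := hcov x hx
        exact ⟨p, hp⟩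
      have h1 := (Finset.card_le_card hYs).trans Finset.card_biUnion_le
      obtain ⟨p, hp, hmax⟩ := P.exists_max_image
        (fun p ↦ (Y.filter fun x ↦ 2 * (nbrDiff G X x p).card ≤ r).card) hPne
      exact ⟨p, hp, h1.trans (Finset.sum_le_card_nsmul _ _ _ hmax)⟩
    set Z := Y.filter fun x ↦ 2 * (nbrDiff G X x p).card ≤ r with hZ
    have hZX : Z ⊆ X := (Finset.filter_subset _ _).trans Finset.sdiff_subset
    have hZc : X.card ≤ 2 * K * Z.card := by
      calc X.card ≤ 2 * Y.card := hYc
        _ ≤ 2 * (K * Z.card) := by gcongr; exact hpY.trans (Nat.mul_le_mul_right Z.card hPK)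
        _ = 2 * K * Z.card := by ring
    have hZne : Z.Nonempty := by
      rw [Finset.nonempty_iff_ne_empty]
      intro h
      rw [h, Finset.card_empty, mul_zero] at hZc
      have := hX.card_pos
      omega
    obtain ⟨A, hAZ, hAm, hA⟩ := hm Z hZX hZne hZc
    have hAd : ∀ B ∈ 𝒞, Disjoint A B := by
      intro B hB
      refine Finset.disjoint_left.2 fun x hx hxB ↦ ?_
      have := (Finset.mem_filter.1 (hAZ hx)).1
      exact (Finset.mem_sdiff.1 this).2 (Finset.mem_biUnion.2 ⟨B, hB, hxB⟩)
    have hAnot : A ∉ 𝒞 := fun h ↦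
      hA.nonempty.ne_empty (Finset.disjoint_self_iff_empty _ |>.1 (hAd A h))
    refine ⟨insert A 𝒞, by rw [Finset.card_insert_of_notMem hAnot, h𝒞j], ?_, ?_⟩
    · intro B hB
      rcases Finset.mem_insert.1 hB with rfl | hB
      · refine ⟨hAZ.trans hZX, hAm, hA, fun u hu v hv ↦ ?_⟩
        have h1 := (Finset.mem_filter.1 (hAZ hu)).2
        have h2 := (Finset.mem_filter.1 (hAZ hv)).2
        have h3 := card_nbrDiff_le (G := G) X u v p
        omega
      · exact h𝒞 B hB
    · intro B hB C hC hBC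
      rcases Finset.mem_insert.1 hB with rfl | hB' <;> rcases Finset.mem_insert.1 hC with rfl | hC'
      · exact absurd rfl hBC
      · exact hAd C hC'
      · exact (hAd B hB').symm
      · exact hdisj B hB' C hC' hBC

/-- One step of the recursion: if large parts of neighbourhood classes contain cographs on `m`
vertices and sets of `t` vertices contain cographs on `q` vertices, then `X` contains a cograph on
`m * q` vertices. Two disjoint cells fail to be completely joined or completely non-adjacent only if
one of them meets the difference of the neighbourhoods of two vertices of the other, which is a
rare event as these differences are small. -/
theorem exists_isCographOn_mul {X P : Finset V} {K m r t q : ℕ} (hX : X.Nonempty)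
    (hPK : P.card ≤ K)
    (hcov : ∀ x ∈ X, ∃ p ∈ P, 2 * (nbrDiff G X x p).card ≤ r)
    (hm : ∀ Z ⊆ X, Z.Nonempty → X.card ≤ 2 * K * Z.card → ∃ A ⊆ Z, A.card = m ∧ IsCographOn G A)
    (ht : ∀ T ⊆ X, T.card = t → ∃ S ⊆ T, q ≤ S.card ∧ IsCographOn G S)
    (hn : 2 * m * (t * (2 * (m * m * r) + 1)) ≤ X.card) :
    ∃ S ⊆ X, m * q ≤ S.card ∧ IsCographOn G S := by
  obtain ⟨𝒞, h𝒞j, h𝒞, hdisj⟩ := exists_cells hPK hcov hm _ hn hX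
  set U : Finset V → Finset V := fun A ↦ (A ×ˢ A).biUnion fun w ↦ nbrDiff G X w.1 w.2 with hU
  obtain ⟨I, hI, hIt, hIR⟩ := exists_pairwise_unrelated
    (fun A B : Finset V ↦ ¬ Disjoint B (U A)) (m * m * r) t 𝒞 (by
      intro A hA
      have hUc : (U A).card ≤ m * m * r := by
        have := Finset.card_biUnion_le_card_mul (A ×ˢ A) (fun w ↦ nbrDiff G X w.1 w.2) r
          fun w hw ↦ (h𝒞 A hA).2.2.2 w.1 (Finset.mem_product.1 hw).1 w.2 (Finset.mem_product.1 hw).2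
        rwa [Finset.card_product, (h𝒞 A hA).2.1] at this
      refine le_trans ?_ hUc
      have hex : ∀ B : Finset V, ∃ x, ¬ Disjoint B (U A) → x ∈ B ∧ x ∈ U A := by
        intro B
        by_cases hB : Disjoint B (U A)
        · obtain ⟨x, -⟩ := hX
          exact ⟨x, fun h ↦ absurd hB h⟩
        · obtain ⟨x, hx⟩ := Finset.not_disjoint_iff.1 hB
          exact ⟨x, fun _ ↦ hx⟩
      choose f hf using hex
      refine Finset.card_le_card_of_injOn f (fun B hB ↦ ?_) fun B hB C hC hBC ↦ ?_
      · simp only [Finset.coe_filter, Set.mem_ofPred_eq] at hB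
        exact (hf B hB.2).2
      · simp only [Finset.coe_filter, Set.mem_ofPred_eq] at hB hC
        by_contra hne
        exact Finset.disjoint_left.1 (hdisj B hB.1 C hC.1 hne) (hf B hB.2).1
          (hBC ▸ (hf C hC.2).1)) h𝒞j.ge
  -- the adjacency between distinct selected cells does not depend on the chosen vertices
  have hrow : ∀ A ∈ I, ∀ B ∈ I, A ≠ B → ∀ u ∈ A, ∀ v ∈ A, ∀ w ∈ B, (G.Adj u w ↔ G.Adj v w) := by
    intro A hA B hB hAB u hu v hv w hw
    by_contra hne
    refine hIR A hA B hB hAB (Finset.not_disjoint_iff.2 ⟨w, hw, ?_⟩)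
    exact Finset.mem_biUnion.2 ⟨(u, v), Finset.mem_product.2 ⟨hu, hv⟩,
      mem_nbrDiff.2 ⟨(h𝒞 B (hI hB)).1 hw, hne⟩⟩
  have hclean : ∀ A ∈ I, ∀ B ∈ I, A ≠ B → ∀ u ∈ A, ∀ v ∈ A, ∀ w ∈ B, ∀ z ∈ B,
      (G.Adj u w ↔ G.Adj v z) := by
    intro A hA B hB hAB u hu v hv w hw z hz
    rw [hrow A hA B hB hAB u hu v hv w hw, G.adj_comm v w, G.adj_comm v z]
    exact hrow B hB A hA hAB.symm w hw z hz v hv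
  have hne : ∀ A : Finset V, ∃ x, A ∈ I → x ∈ A := by
    intro A
    by_cases hA : A ∈ I
    · obtain ⟨x, hx⟩ := (h𝒞 A (hI hA)).2.2.1.nonempty
      exact ⟨x, fun _ ↦ hx⟩
    · obtain ⟨x, -⟩ := hX
      exact ⟨x, fun h ↦ absurd h hA⟩
  choose rep hrep using hne
  have hinj : Set.InjOn rep (I : Set (Finset V)) := by
    intro A hA B hB hAB
    by_contra hne
    exact Finset.disjoint_left.1 (hdisj A (hI hA) B (hI hB) hne) (hrep A hA) (hAB ▸ hrep B hB)
  obtain ⟨S, hST, hqS, hS⟩ := ht (I.image rep)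
    (fun x hx ↦ by
      obtain ⟨A, hA, rfl⟩ := Finset.mem_image.1 hx
      exact (h𝒞 A (hI hA)).1 (hrep A hA))
    (by rw [Finset.card_image_of_injOn hinj, hIt])
  have hcell : ∀ x : V, ∃ A : Finset V, x ∈ S → A ∈ I ∧ rep A = x := by
    intro x
    by_cases hx : x ∈ S
    · obtain ⟨A, hA, hAx⟩ := Finset.mem_image.1 (hST hx)
      exact ⟨A, fun _ ↦ ⟨hA, hAx⟩⟩
    · exact ⟨∅, fun h ↦ absurd h hx⟩
  choose cell hcell using hcell
  have hcne : ∀ s ∈ S, ∀ s' ∈ S, s ≠ s' → cell s ≠ cell s' := by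
    intro s hs s' hs' hne h
    exact hne (by rw [← (hcell s hs).2, ← (hcell s' hs').2, h])
  have hcdisj : ∀ s ∈ S, ∀ s' ∈ S, s ≠ s' → Disjoint (cell s) (cell s') := fun s hs s' hs' hne ↦
    hdisj _ (hI (hcell s hs).1) _ (hI (hcell s' hs').1) (hcne s hs s' hs' hne)
  have hmem : ∀ s ∈ S, s ∈ cell s := fun s hs ↦ by
    have h := hrep _ (hcell s hs).1
    rwa [(hcell s hs).2] at h
  refine ⟨S.biUnion cell, ?_, ?_, ?_⟩
  · exact Finset.biUnion_subset.2 fun s hs ↦ (h𝒞 _ (hI (hcell s hs).1)).1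
  · rw [Finset.card_biUnion hcdisj,
      Finset.sum_congr rfl fun s hs ↦ (h𝒞 _ (hI (hcell s hs).1)).2.1, Finset.sum_const,
      smul_eq_mul, mul_comm]
    exact Nat.mul_le_mul_right m hqS
  · exact hS.biUnion cell (fun s hs ↦ (h𝒞 _ (hI (hcell s hs).1)).2.2.1) hcdisj
      fun s hs s' hs' hne a ha b hb ↦
        hclean _ (hcell s hs).1 _ (hcell s' hs').1 (hcne s hs s' hs' hne) a ha s (hmem s hs)
          b hb s' (hmem s' hs')

/-- A maximal `η`-separated set of vertices is an `η`-net for the neighbourhoods. -/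
theorem exists_net (G : SimpleGraph V) (X : Finset V) (η : ℝ) :
    ∃ P ⊆ X, (∀ x ∈ P, ∀ y ∈ P, x ≠ y → η * X.card ≤ (nbrDiff G X x y).card) ∧
      ∀ x ∈ X, x ∉ P → ∃ p ∈ P, ((nbrDiff G X x p).card : ℝ) < η * X.card := by
  have hsymm : ∀ x y, nbrDiff G X x y = nbrDiff G X y x := fun x y ↦ by
    ext w; simp only [mem_nbrDiff]; tauto
  obtain ⟨Sep, hSep⟩ : ∃ Sep : Finset V → Prop, ∀ P, Sep P ↔ ∀ x ∈ P, ∀ y ∈ P, x ≠ y →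
    η * X.card ≤ (nbrDiff G X x y).card := ⟨_, fun _ ↦ Iff.rfl⟩
  obtain ⟨P, hP, hmax⟩ := (X.powerset.filter Sep).exists_max_image Finset.card
    ⟨∅, by simp [hSep]⟩
  rw [Finset.mem_filter, Finset.mem_powerset, hSep] at hP
  refine ⟨P, hP.1, hP.2, fun x hx hxP ↦ ?_⟩
  by_contra! hfar
  have := hmax (insert x P) (by
    rw [Finset.mem_filter, Finset.mem_powerset, hSep]
    refine ⟨Finset.insert_subset hx hP.1, fun y hy z hz hyz ↦ ?_⟩
    rcases Finset.mem_insert.1 hy with rfl | hy' <;> rcases Finset.mem_insert.1 hz with rfl | hz'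
    · exact absurd rfl hyz
    · exact hfar z hz'
    · rw [hsymm]; exact hfar y hy'
    · exact hP.2 y hy' z hz' hyz)
  rw [Finset.card_insert_of_notMem hxP] at this
  omega

end Cells

/-! ### Solving the recursion -/

/-- The inequality behind the recursion for `log f(eˣ) ≈ xᵖ`: passing from `x` to `x - A xᵖ` loses
at most `A x ^ (2 p - 1)`, which is at most the gain `x ^ (p ^ 2)` for large `x`, since
`p ^ 2 > 2 p - 1`. -/
theorem rpow_le_sub_rpow_add_rpow {p A x : ℝ} (hp0 : 0 < p) (hp1 : p < 1) (hA : 0 ≤ A) (hx : 1 ≤ x)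
    (h1 : A * x ^ p ≤ x) (h2 : A ≤ x ^ ((1 - p) ^ 2)) :
    x ^ p ≤ (x - A * x ^ p) ^ p + (x ^ p) ^ p := by
  have hx0 : 0 < x := by linarith
  set v : ℝ := A * x ^ p / x with hv
  have hv0 : 0 ≤ v := by positivity
  have hv1 : v ≤ 1 := by rw [hv, div_le_one hx0]; exact h1
  have hfac : x - A * x ^ p = x * (1 - v) := by rw [hv]; field_simp
  have hb : 1 - v ≤ (1 - v) ^ p := by
    have := Real.rpow_le_rpow_of_exponent_ge' (by linarith : 0 ≤ 1 - v) (by linarith) hp0.le hp1.le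
    rwa [Real.rpow_one] at this
  have hloss : x ^ p * v ≤ (x ^ p) ^ p := by
    have he : x ^ p * v = A * x ^ (2 * p - 1) := by
      rw [hv, show 2 * p - 1 = p + p - 1 by ring, Real.rpow_sub hx0, Real.rpow_add hx0,
        Real.rpow_one]
      ring
    rw [he, ← Real.rpow_mul hx0.le, show p * p = (1 - p) ^ 2 + (2 * p - 1) by ring,
      Real.rpow_add hx0]
    exact mul_le_mul_of_nonneg_right h2 (Real.rpow_nonneg hx0.le _)
  rw [hfac, Real.mul_rpow hx0.le (by linarith)]
  have := mul_le_mul_of_nonneg_left hb (Real.rpow_nonneg hx0.le p)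
  linarith

set_option maxHeartbeats 1000000 in
/-- Cographs of size `exp (c (log |X|) ^ p)` inside every vertex set `X`, by induction on `|X|`. With
`L = (log |X|) ^ p`, the recursion is applied with separation `exp (-5 L)`, with about `exp L` cells,
and with cells of size at most `2 exp L` lying in classes of size `|X| exp (-A L)`. -/
theorem exists_isCographOn_exp_le (d : ℕ) {p : ℝ} (hp0 : 0 < p) (hp1 : p < 1) :
    ∃ c : ℝ, 0 < c ∧ ∀ {V : Type u} (G : SimpleGraph V), ShattersAtMost G d →
      ∀ X : Finset V, X.Nonempty → ∃ S ⊆ X, IsCographOn G S ∧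
        Real.exp (c * Real.log X.card ^ p) ≤ S.card := by
  obtain ⟨B, hB1, hB⟩ := exists_packing_bound.{u} d
  set A : ℝ := 10 * d + 3 with hA
  have hA3 : 3 ≤ A := by rw [hA]; linarith [Nat.cast_nonneg (α := ℝ) d]
  have hL : Tendsto (fun x : ℝ ↦ x ^ p) atTop atTop := tendsto_rpow_atTop hp0
  have hE : Tendsto (fun x : ℝ ↦ Real.exp (x ^ p)) atTop atTop := Real.tendsto_exp_atTop.comp hL
  obtain ⟨x₀, hx₀⟩ := Filter.eventually_atTop.1
    ((hE.eventually_ge_atTop (2 * B ^ d)).and ((hE.eventually_ge_atTop 512).and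
      (((tendsto_rpow_atTop (by linarith : 0 < 1 - p)).eventually_ge_atTop A).and
      (((tendsto_rpow_atTop (pow_pos (by linarith : 0 < 1 - p) 2)).eventually_ge_atTop A).and
      (eventually_ge_atTop (1 : ℝ))))))
  set x₁ : ℝ := max x₀ 1 with hx₁
  have hx₁1 : 1 ≤ x₁ := le_max_right _ _
  have hx₁p : 0 < x₁ ^ p := Real.rpow_pos_of_pos (by linarith) p
  have hlog2 : 0 < Real.log 2 := Real.log_pos (by norm_num)
  set c : ℝ := min 1 (Real.log 2 / x₁ ^ p) with hc
  have hc0 : 0 < c := lt_min one_pos (by positivity)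
  have hc1 : c ≤ 1 := min_le_left _ _
  have hc2 : c * x₁ ^ p ≤ Real.log 2 := by
    rw [← le_div_iff₀ hx₁p]; exact min_le_right _ _
  refine ⟨c, hc0, fun {V} G hG X hXne ↦ ?_⟩
  induction hn : X.card using Nat.strong_induction_on generalizing X with
  | _ n ih =>
  classical
  have hn1 : 1 ≤ n := hn ▸ hXne.card_pos
  have hnpos : (0 : ℝ) < n := by exact_mod_cast hn1
  rcases hn1.eq_or_lt with h1 | hn2
  · obtain ⟨v, hv⟩ := hXne
    exact ⟨{v}, by simpa using hv, .singleton v, by simp [← h1, Real.zero_rpow hp0.ne']⟩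
  set x := Real.log n with hx
  have hx0 : 0 ≤ x := Real.log_nonneg (by exact_mod_cast hn1)
  have hexpx : Real.exp x = n := Real.exp_log hnpos
  rcases le_or_gt x x₁ with hsmall | hbig
  · obtain ⟨u, hu, v, hv, huv⟩ := Finset.one_lt_card.1 (hn.symm ▸ hn2)
    refine ⟨{u, v}, Finset.insert_subset hu (by simpa using hv), .pair huv, ?_⟩
    rw [Finset.card_pair huv]
    have h2 : c * x ^ p ≤ Real.log 2 :=
      le_trans (mul_le_mul_of_nonneg_left (Real.rpow_le_rpow hx0 hsmall hp0.le) hc0.le) hc2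
    calc Real.exp (c * x ^ p) ≤ Real.exp (Real.log 2) := Real.exp_le_exp.2 h2
      _ = ((2 : ℕ) : ℝ) := by rw [Real.exp_log (by norm_num)]; norm_num
  obtain ⟨e1, e2, e3, e4, hx1⟩ := hx₀ x ((le_max_left _ _).trans hbig.le)
  have hxpos : 0 < x := by linarith
  set L := x ^ p with hLdef
  have hL0 : 0 < L := Real.rpow_pos_of_pos hxpos p
  set E := Real.exp L with hEdef
  have hAL : A * L ≤ x := by
    calc A * L ≤ x ^ (1 - p) * x ^ p := by gcongr
      _ = x := by rw [← Real.rpow_add hxpos]; simp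
  have hkey := rpow_le_sub_rpow_add_rpow hp0 hp1 (by linarith) hx1 hAL e4
  have hE0 : 0 < E := Real.exp_pos _
  have hE3 : E ^ 3 ≤ n := by
    rw [hEdef, ← Real.exp_nat_mul, ← hexpx]
    refine Real.exp_le_exp.2 ?_
    push_cast
    nlinarith
  -- the power `5` makes `m ^ 3 * t * η` at most of order `E ^ (-1)` when `m` and `t` are at most `2 E`
  set η : ℝ := (E ^ 5)⁻¹ with hη
  have hη0 : 0 < η := by positivity
  have hη1 : η ≤ 1 := inv_le_one_of_one_le₀ (one_le_pow₀ (by linarith))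
  obtain ⟨P, hPX, hPsep, hPnet⟩ := exists_net G X η
  have hPne : P.Nonempty := by
    by_contra h
    rw [Finset.not_nonempty_iff_eq_empty] at h
    obtain ⟨v, hv⟩ := hXne
    obtain ⟨q, hq, -⟩ := hPnet v hv (by simp [h])
    simp [h] at hq
  set K := P.card with hK
  have hK1 : 1 ≤ K := hPne.card_pos
  have hKr : (1 : ℝ) ≤ K := by exact_mod_cast hK1
  have hK2 : 2 * (K : ℝ) ≤ Real.exp (A * L) := by
    have h1 := hB G hG X P η hXne hη0 hη1 hPsep
    have h2 : (B / η ^ 2) ^ d = B ^ d * E ^ (10 * d) := by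
      rw [hη, inv_pow, div_inv_eq_mul, mul_pow, ← pow_mul, ← pow_mul]
      ring_nf
    rw [h2] at h1
    calc 2 * (K : ℝ) ≤ (2 * B ^ d) * E ^ (10 * d) := by linarith
      _ ≤ E * E ^ (10 * d) := by gcongr
      _ = E ^ (10 * d + 1) := by ring
      _ ≤ E ^ (10 * d + 3) := pow_le_pow_right₀ (by linarith) (by omega)
      _ = Real.exp (A * L) := by
        rw [hEdef, ← Real.exp_nat_mul, hA]; push_cast; rfl
  set y := x - A * L with hy
  have hy0 : 0 ≤ y := by linarith
  have hyx : y ≤ x := by nlinarith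
  set m := ⌈Real.exp (c * y ^ p)⌉₊ with hm
  have hm0 : 0 < m := Nat.ceil_pos.2 (Real.exp_pos _)
  have hm2 : (m : ℝ) ≤ 2 * E := by
    have h1 : (m : ℝ) < Real.exp (c * y ^ p) + 1 := Nat.ceil_lt_add_one (Real.exp_pos _).le
    have h2 : c * y ^ p ≤ L := by
      calc c * y ^ p ≤ 1 * y ^ p := by gcongr
        _ = y ^ p := one_mul _
        _ ≤ L := Real.rpow_le_rpow hy0 hyx hp0.le
    have h3 : Real.exp (c * y ^ p) ≤ E := Real.exp_le_exp.2 h2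
    linarith
  set t := ⌈E⌉₊ with ht
  have ht0 : 0 < t := Nat.ceil_pos.2 hE0
  have ht2 : (t : ℝ) ≤ 2 * E := by
    have : (t : ℝ) < E + 1 := Nat.ceil_lt_add_one hE0.le
    linarith
  set r := ⌊2 * η * n⌋₊ with hr
  have hrr : (r : ℝ) ≤ 2 * η * n := Nat.floor_le (by positivity)
  have htn : t < n := by
    have : (t : ℝ) < n := by nlinarith [sq_nonneg E, mul_pos hE0 hE0]
    exact_mod_cast this
  have hstep : ∃ S ⊆ X, m * ⌈Real.exp (c * L ^ p)⌉₊ ≤ S.card ∧ IsCographOn G S := by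
    refine exists_isCographOn_mul (P := P) (K := K) (r := r) (t := t) hXne le_rfl ?_ ?_ ?_ ?_
    · intro v hv
      by_cases hvP : v ∈ P
      · refine ⟨v, hvP, ?_⟩
        have : nbrDiff G X v v = ∅ := by ext w; simp [mem_nbrDiff]
        simp [this]
      · obtain ⟨q, hq, hvq⟩ := hPnet v hv hvP
        refine ⟨q, hq, Nat.le_floor ?_⟩
        rw [hn] at hvq
        push_cast
        linarith
    · intro Z hZX hZne hZ
      -- a subset of size `⌈n / (2 K)⌉ < n` serves the induction even if `Z = X`
      set k := ⌈(n : ℝ) / (2 * K)⌉₊ with hk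
      have hkZ : k ≤ Z.card := by
        refine Nat.ceil_le.2 ?_
        rw [div_le_iff₀ (by positivity), mul_comm]
        rw [hn] at hZ
        exact_mod_cast hZ
      have hkr : (n : ℝ) / (2 * K) ≤ k := Nat.le_ceil _
      have hk0 : 0 < k := Nat.ceil_pos.2 (by positivity)
      have hkn : k < n := by
        have h1 : k ≤ n - 1 := by
          refine Nat.ceil_le.2 ?_
          rw [div_le_iff₀ (by positivity), Nat.cast_sub hn1]
          have : (2 : ℝ) ≤ n := by exact_mod_cast hn2
          push_cast
          nlinarith
        omega
      obtain ⟨Z', hZ', hZ'c⟩ := Finset.exists_subset_card_eq hkZ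
      obtain ⟨S, hSZ, hS, hSc⟩ := ih k hkn Z'
        (Finset.card_pos.1 (hZ'c ▸ hk0)) hZ'c
      have hyk : y ≤ Real.log k := by
        rw [Real.le_log_iff_exp_le (by exact_mod_cast hk0)]
        refine le_trans ?_ hkr
        rw [hy, Real.exp_sub, hexpx]
        gcongr
      have hmS : m ≤ S.card := by
        refine Nat.ceil_le.2 (le_trans (Real.exp_le_exp.2 ?_) hSc)
        gcongr
      obtain ⟨S', hS', hS'c⟩ := Finset.exists_subset_card_eq hmS
      exact ⟨S', hS'.trans (hSZ.trans hZ'), hS'c,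
        hS.mono S' hS' (Finset.card_pos.1 (hS'c ▸ hm0))⟩
    · intro T hTX hTc
      obtain ⟨S, hST, hS, hSc⟩ := ih t htn T (Finset.card_pos.1 (hTc ▸ ht0)) hTc
      refine ⟨S, hST, Nat.ceil_le.2 (le_trans (Real.exp_le_exp.2 ?_) hSc), hS⟩
      have : L ≤ Real.log t := by
        rw [Real.le_log_iff_exp_le (by exact_mod_cast ht0)]
        exact Nat.le_ceil _
      gcongr
    · rw [hn]
      have h1 : 2 * (m : ℝ) * (t * (2 * (m * m * r) + 1)) ≤ n := by
        calc 2 * (m : ℝ) * (t * (2 * (m * m * r) + 1))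
            ≤ 2 * (2 * E) * (2 * E * (2 * (2 * E * (2 * E) * (2 * η * n)) + 1)) := by gcongr
          _ = 128 * (E ^ 4 * η) * n + 8 * E ^ 2 := by ring
          _ ≤ n / 2 + n / 2 := by
            have h2 : E ^ 4 * η = E⁻¹ := by rw [hη]; field_simp
            have h3 : E⁻¹ ≤ 512⁻¹ := inv_anti₀ (by norm_num) e2
            rw [h2]
            gcongr
            · nlinarith
            · nlinarith [sq_nonneg E]
          _ = n := by ring
      exact_mod_cast h1
  obtain ⟨S, hSX, hSc, hS⟩ := hstep
  refine ⟨S, hSX, hS, ?_⟩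
  calc Real.exp (c * L) ≤ Real.exp (c * y ^ p) * Real.exp (c * L ^ p) := by
        rw [← Real.exp_add, ← mul_add]
        exact Real.exp_le_exp.2 (mul_le_mul_of_nonneg_left hkey hc0.le)
    _ ≤ (m : ℝ) * (⌈Real.exp (c * L ^ p)⌉₊ : ℝ) := by
        gcongr <;> exact Nat.le_ceil _
    _ ≤ S.card := by exact_mod_cast hSc

/-! ### Homogeneous sets -/

/-- Every graph on `n` vertices of VC-dimension at most `d` has a clique or an independent set of
size at least `h`. -/
def ForcesHomogeneous (d n h : ℕ) : Prop :=
  ∀ (V : Type u) [Fintype V] (G : SimpleGraph V), Fintype.card V = n → graphVCDim G ≤ d →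
    ∃ S : Finset V, (G.IsClique (S : Set V) ∨ G.IsIndepSet (S : Set V)) ∧ h ≤ S.card

open Classical in
/-- The largest `h` such that every graph on `n` vertices of VC-dimension at most `d` has a clique
or an independent set of size at least `h`. The search stops at `n`, as no vertex set is larger. -/
noncomputable def homogeneousNumber (d n : ℕ) : ℕ :=
  Nat.findGreatest (ForcesHomogeneous.{u} d n) n

theorem homogeneousNumber_le (d n : ℕ) : homogeneousNumber.{u} d n ≤ n := by
  classical
  exact Nat.findGreatest_le n

theorem forcesHomogeneous_homogeneousNumber (d n : ℕ) :
    ForcesHomogeneous.{u} d n (homogeneousNumber.{u} d n) := by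
  classical
  exact Nat.findGreatest_spec (P := ForcesHomogeneous.{u} d n) (Nat.zero_le n)
    fun _ _ _ _ _ ↦ ⟨∅, by simp, by simp⟩

theorem le_homogeneousNumber {d n h : ℕ} (hn : h ≤ n) (H : ForcesHomogeneous.{u} d n h) :
    h ≤ homogeneousNumber.{u} d n := by
  classical
  exact Nat.le_findGreatest hn H

theorem min_two_le_homogeneousNumber (d n : ℕ) : min n 2 ≤ homogeneousNumber.{u} d n := by
  classical
  refine le_homogeneousNumber (min_le_left _ _) fun V _ G hV _ ↦ ?_
  obtain ⟨S, -, hS⟩ := Finset.exists_subset_card_eq (s := (Finset.univ : Finset V)) (n := min n 2)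
    (by rw [Finset.card_univ, hV]; exact min_le_left _ _)
  refine ⟨S, ?_, hS.ge⟩
  rcases (hS.le.trans (min_le_right _ _)).lt_or_eq with h | h
  · left
    rw [SimpleGraph.IsClique]
    exact (Finset.card_le_one_iff_subsingleton.1 (by omega)).pairwise _
  · obtain ⟨a, b, hab, rfl⟩ := Finset.card_eq_two.1 h
    by_cases hadj : G.Adj a b
    · left
      simpa [SimpleGraph.isClique_insert] using fun _ ↦ hadj
    · right
      intro u hu v hv huv
      simp only [Finset.coe_insert, Finset.coe_singleton, Set.mem_insert_iff,
        Set.mem_singleton_iff] at hu hv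
      rcases hu with rfl | rfl <;> rcases hv with rfl | rfl
      · exact absurd rfl huv
      · exact hadj
      · exact fun h ↦ hadj h.symm
      · exact absurd rfl huv

/-- A cograph on `exp (c (log n) ^ (1 - δ / 2))` vertices contains a homogeneous set of at least the
square root of this size, which exceeds `exp ((log n) ^ (1 - δ))` for large `n`. -/
theorem eventually_exp_le_homogeneousNumber (d : ℕ) {δ : ℝ} (hδ0 : 0 < δ) (hδ1 : δ < 1) :
    ∀ᶠ n : ℕ in atTop, Real.exp (Real.log n ^ (1 - δ)) ≤ homogeneousNumber.{u} d n := by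
  obtain ⟨c, hc0, hc⟩ := exists_isCographOn_exp_le.{u} d (p := 1 - δ / 2) (by linarith) (by linarith)
  have hlog : Tendsto (fun n : ℕ ↦ Real.log n) atTop atTop :=
    Real.tendsto_log_atTop.comp tendsto_natCast_atTop_atTop
  filter_upwards [hlog.eventually_ge_atTop 1,
    ((tendsto_rpow_atTop (half_pos hδ0)).comp hlog).eventually_ge_atTop (2 / c),
    eventually_ge_atTop 1] with n hn1 hn2 hn3
  have hx0 : 0 < Real.log n := by linarith
  have hn0 : (0 : ℝ) < n := by exact_mod_cast hn3
  have hle : 2 * Real.log n ^ (1 - δ) ≤ c * Real.log n ^ (1 - δ / 2) := by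
    have h1 : Real.log n ^ (1 - δ / 2) = Real.log n ^ (δ / 2) * Real.log n ^ (1 - δ) := by
      rw [← Real.rpow_add hx0]; ring_nf
    rw [h1, ← mul_assoc]
    refine mul_le_mul_of_nonneg_right ?_ (Real.rpow_nonneg hx0.le _)
    simp only [Function.comp_apply, div_le_iff₀ hc0] at hn2
    linarith
  suffices h : ⌈Real.exp (Real.log n ^ (1 - δ))⌉₊ ≤ homogeneousNumber.{u} d n from
    Nat.ceil_le.1 h
  refine le_homogeneousNumber ?_ fun V _ G hV hG ↦ ?_
  · refine Nat.ceil_le.2 ?_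
    conv_rhs => rw [← Real.exp_log hn0]
    refine Real.exp_le_exp.2 ?_
    conv_rhs => rw [← Real.rpow_one (Real.log n)]
    exact Real.rpow_le_rpow_of_exponent_le hn1 (by linarith)
  · have hne : (Finset.univ : Finset V).Nonempty := by
      rw [← Finset.card_pos, Finset.card_univ]; omega
    obtain ⟨S, -, hS, hSc⟩ := hc G (shattersAtMost_of_graphVCDim_le hG) Finset.univ hne
    rw [Finset.card_univ, hV] at hSc
    obtain ⟨Q, -, I, -, hQ, hI, hQI⟩ := hS.exists_isClique_isIndepSet
    have hsq : Real.exp (Real.log n ^ (1 - δ)) ^ 2 ≤ (Q.card : ℝ) * I.card := by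
      rw [← Real.exp_nat_mul]
      refine (Real.exp_le_exp.2 (by push_cast; exact hle)).trans (hSc.trans ?_)
      exact_mod_cast hQI
    have hpos := Real.exp_pos (Real.log n ^ (1 - δ))
    rcases le_total Q.card I.card with h | h
    · refine ⟨I, Or.inr hI, Nat.ceil_le.2 ?_⟩
      have h' : (Q.card : ℝ) ≤ I.card := by exact_mod_cast h
      refine le_of_sq_le_sq ?_ (Nat.cast_nonneg _)
      nlinarith [Nat.cast_nonneg (α := ℝ) I.card]
    · refine ⟨Q, Or.inl hQ, Nat.ceil_le.2 ?_⟩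
      have h' : (I.card : ℝ) ≤ Q.card := by exact_mod_cast h
      refine le_of_sq_le_sq ?_ (Nat.cast_nonneg _)
      nlinarith [Nat.cast_nonneg (α := ℝ) Q.card]

/-- For `n ≥ 3`, the number `ε` with `exp ((log n) ^ (1 - ε)) = homogeneousNumber d n`. -/
noncomputable def homogeneousExponent (d n : ℕ) : ℝ :=
  if n < 3 then 0
  else 1 - Real.log (Real.log (homogeneousNumber.{u} d n)) / Real.log (Real.log n)

theorem one_lt_log_natCast {n : ℕ} (hn : 3 ≤ n) : 1 < Real.log n := by
  rw [Real.lt_log_iff_exp_lt (by positivity)]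
  have : (3 : ℝ) ≤ n := by exact_mod_cast hn
  linarith [Real.exp_one_lt_d9]

theorem exp_log_rpow_homogeneousExponent {d n : ℕ} (hn : 3 ≤ n) :
    Real.exp (Real.log n ^ (1 - homogeneousExponent.{u} d n)) = homogeneousNumber.{u} d n := by
  have h2 : 2 ≤ homogeneousNumber.{u} d n := by
    have := min_two_le_homogeneousNumber.{u} d n; omega
  have h2' : (1 : ℝ) < homogeneousNumber.{u} d n := by exact_mod_cast h2
  have hlog := one_lt_log_natCast hn
  have hll : 0 < Real.log (Real.log n) := Real.log_pos hlog
  rw [homogeneousExponent, if_neg (by omega), sub_sub_cancel, Real.rpow_def_of_pos (by linarith),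
    mul_div_cancel₀ _ hll.ne', Real.exp_log (Real.log_pos h2'), Real.exp_log (by linarith)]

theorem tendsto_homogeneousExponent (d : ℕ) :
    Tendsto (homogeneousExponent.{u} d) atTop (𝓝 0) := by
  rw [tendsto_order]
  have hlow : ∀ n, 3 ≤ n → 0 ≤ homogeneousExponent.{u} d n := by
    intro n hn
    by_contra! hneg
    have hlog := one_lt_log_natCast hn
    have h1 : Real.log n < Real.log n ^ (1 - homogeneousExponent.{u} d n) := by
      conv_lhs => rw [← Real.rpow_one (Real.log n)]
      exact Real.rpow_lt_rpow_of_exponent_lt hlog (by linarith)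
    have h2 := Real.exp_lt_exp.2 h1
    rw [exp_log_rpow_homogeneousExponent hn, Real.exp_log (by positivity)] at h2
    have := homogeneousNumber_le.{u} d n
    have h3 : n < homogeneousNumber.{u} d n := by exact_mod_cast h2
    omega
  refine ⟨fun a ha ↦ ?_, fun a ha ↦ ?_⟩
  · filter_upwards [eventually_ge_atTop 3] with n hn
    exact ha.trans_le (hlow n hn)
  · set δ := min (a / 2) (1 / 2) with hδ
    have hδ0 : 0 < δ := lt_min (by linarith) (by norm_num)
    have hδ1 : δ < 1 := (min_le_right _ _).trans_lt (by norm_num)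
    have hδa : δ < a := (min_le_left _ _).trans_lt (by linarith)
    filter_upwards [eventually_ge_atTop 3, eventually_exp_le_homogeneousNumber.{u} d hδ0 hδ1]
      with n hn h
    rw [← exp_log_rpow_homogeneousExponent hn, Real.exp_le_exp,
      Real.rpow_le_rpow_left_iff (one_lt_log_natCast hn)] at h
    linarith

theorem theorem1 (d : ℕ) (hd : 1 ≤ d) :
    -- a clique or an independent set of size at least `exp ((log n) ^ (1 - o(1)))`
    (∃ ε : ℕ → ℝ, Tendsto ε atTop (𝓝 0) ∧
      ∀ (V : Type u) [Fintype V] [Nonempty V] (G : SimpleGraph V), graphVCDim G ≤ d →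
        ∃ S : Finset V, (G.IsClique (S : Set V) ∨ G.IsIndepSet (S : Set V)) ∧
          Real.exp (Real.log (Fintype.card V) ^ (1 - ε (Fintype.card V))) ≤ (S.card : ℝ)) ∧
    -- an induced cograph on at least `exp (c * (log n) ^ (1 - δ))` vertices
    (∀ δ : ℝ, 0 < δ → δ < 1 / 2 → ∃ c : ℝ, 0 < c ∧
      ∀ (V : Type u) [Fintype V] [Nonempty V] (G : SimpleGraph V), graphVCDim G ≤ d →
        ∃ S : Finset V, IsCograph (G.induce (S : Set V)) ∧
          Real.exp (c * Real.log (Fintype.card V) ^ (1 - δ)) ≤ (S.card : ℝ)) := by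
  refine ⟨⟨homogeneousExponent.{u} d, tendsto_homogeneousExponent d, fun V _ _ G hG ↦ ?_⟩,
    fun δ hδ0 hδ1 ↦ ?_⟩
  · obtain ⟨S, hS, hSc⟩ := forcesHomogeneous_homogeneousNumber d _ V G rfl hG
    refine ⟨S, hS, ?_⟩
    have hpos : 0 < Fintype.card V := Fintype.card_pos
    rcases lt_or_ge (Fintype.card V) 3 with h3 | h3
    · have hmin := min_two_le_homogeneousNumber.{u} d (Fintype.card V)
      have hle : Fintype.card V ≤ S.card := by omega
      rw [homogeneousExponent, if_pos h3, sub_zero, Real.rpow_one,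
        Real.exp_log (by exact_mod_cast hpos)]
      exact_mod_cast hle
    · rw [exp_log_rpow_homogeneousExponent h3]
      exact_mod_cast hSc
  · obtain ⟨c, hc0, hc⟩ := exists_isCographOn_exp_le.{u} d (p := 1 - δ) (by linarith) (by linarith)
    refine ⟨c, hc0, fun V _ _ G hG ↦ ?_⟩
    obtain ⟨S, -, hS, hSc⟩ := hc G (shattersAtMost_of_graphVCDim_le hG) Finset.univ
      Finset.univ_nonempty
    exact ⟨S, hS.isCograph, by rwa [Finset.card_univ] at hSc⟩
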